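/- Let $d\ge 2$ and $r\ge 1$ be integers and let $P_k^+,P_k^-\in\mathbb R^{r\times r}$ ($k\in\mathbb Z$). Let $\phi=[\phi_1,\dots,\phi_r]^T:\mathbb R\to\mathbb C^r$ be a two-direction multiscaling function with dilation factor $d$: that is, $$\phi(x)=\sqrt d\sum_{k\in\mathbb Z}\bigl[P_k^+\phi(dx-k)+P_k^-\phi(k-dx)\bigr]\quad\text{for a.e. }x,$$ and $\phi$ generates a multiresolution approximation of $L^2(\mathbb R)$, i.e. $\phi_i\in L^2(\mathbb R)$, the closed spans $V_n$ of $\{\phi_i(d^nx-k),\ \phi_i(k-d^nx): 1\le i\le r,\ k\in\mathbb Z\}$ ($n\in\mathbb Z$) are nested ($V_n\subset V_{n+1}$), $\bigcup_nV_n$ is dense in $L^2(\mathbb R)$, $\bigcap_nV_n=\{0\}$, and the functions $\phi_i(x-k),\phi_i(k-x)$ form a Riesz basis of $V_0$. Assume that * $\phi$ is orthogonal: $\int\phi(x-j)\phi(x-k)^*\,dx=\delta_{jk}I_r$ and $\int\phi(x-j)\phi(k-x)^*\,dx=0$ for all $j,k\in\mathbb Z$; * $\phi$ is continuous and has compact support;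 * $\phi$ satisfies Condition E: the matrix $M_0^\pm$ below has $1$ as a simple eigenvalue, and all its other eigenvalues are smaller than $1$ in absolute value. Let $\psi^{(s)}:\mathbb R\to\mathbb C^r$, $s=1,\dots,d-1$, be associated two-direction multiwavelets, $\psi^{(s)}(x)=\sqrt d\sum_{k}\bigl[Q_k^{(s)+}\phi(dx-k)+Q_k^{(s)-}\phi(k-dx)\bigr]$ for a.e. $x$, with $Q_k^{(s)\pm}\in\mathbb R^{r\times r}$. Put $\Phi(x)=[\phi(x),\phi(-x)]^T$, $\Psi^{(s)}(x)=[\psi^{(s)}(x),\psi^{(s)}(-x)]^T$ and, for $j=0,1,2,\dots$, $$M_j^\pm=\frac1{\sqrt d}\sum_{k\in\mathbb Z}k^j\begin{bmatrix}P_k^+&P_k^-\\P_{-k}^-&P_{-k}^+\end{bmatrix},\qquad N_j^{(s)\pm}=\frac1{\sqrt d}\sum_{k\in\mathbb Z}k^j\begin{bmatrix}Q_k^{(s)+}&Q_k^{(s)-}\\Q_{-k}^{(s)-}&Q_{-k}^{(s)+}\end{bmatrix},$$ $$\mathbf m_j=\int x^j\phi(x)\,dx,\quad \mathbf m_j^\pm=\int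 x^j\Phi(x)\,dx,\quad \mathbf n_j^{(s)}=\int x^j\psi^{(s)}(x)\,dx,\quad \mathbf n_j^{(s)\pm}=\int x^j\Psi^{(s)}(x)\,dx .$$ Then the series for $M_j^\pm$ and the integrals for $\mathbf m_j^\pm$ converge absolutely for all $j\ge0$, and: 1. $M_0^\pm\mathbf m_0^\pm=\mathbf m_0^\pm$ and $(\mathbf m_0^\pm)^*\mathbf m_0^\pm=1$; these two conditions determine $\mathbf m_0^\pm$ up to a factor $c\in\mathbb C$ with $|c|=1$. 2. For every $j\ge1$ the matrix $d^jI_{2r}-M_0^\pm$ is invertible and $$\mathbf m_j^\pm=(d^jI_{2r}-M_0^\pm)^{-1}\sum_{\ell=0}^{j-1}\binom j\ell M_{j-\ell}^\pm\mathbf m_\ell^\pm .$$ Once $\mathbf m_0^\pm$ is given, this recursion determines all $\mathbf m_j^\pm$ uniquely. 3. For all $s=1,\dots,d-1$ and every $j\ge0$ for which the moment $\mathbf n_j^{(s)}$ exists (that is, $x^j\psi^{(s)}(x)$ is integrable; for all $j$ if $\psi^{(s)}$ has compact support), the integral for $\mathbf n_j^{(s)\pm}$ and the series for $N_0^{(s)\pm},\dots,N_j^{(s)\pm}$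 converge absolutely, and $$\mathbf n_j^{(s)\pm}=d^{-j}\sum_{\ell=0}^{j}\binom j\ell N_{j-\ell}^{(s)\pm}\mathbf m_\ell^\pm .$$ 4. $\mathbf m_j$ is the upper half of $\mathbf m_j^\pm$ for all $j\ge 0$, and $\mathbf n_j^{(s)}$ is the upper half of $\mathbf n_j^{(s)\pm}$ for all $s$, $j$ as in 3. -/

import Mathlib

open MeasureTheory

namespace TwoDirection

noncomputable section

/-- A real matrix, regarded as a complex one. -/
def toComplex {m n : Type*} (A : Matrix m n ℝ) : Matrix m n ℂ := A.map (fun t => (t : ℂ))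

/-- The matrix-valued inner product `⟨f, g⟩ = ∫ f(x) g(x)^* dx`. -/
def innerMat {r : ℕ} (f g : ℝ → Fin r → ℂ) : Matrix (Fin r) (Fin r) ℂ :=
  Matrix.of fun a b => ∫ x, f x a * star (g x b)

/-- `f(x) = √d ∑_k [A_k^+ φ(d x - k) + A_k^- φ(k - d x)]`, for almost every `x`. -/
def IsTwoDirectionSeries {r : ℕ} (d : ℕ) (Ap Am : ℤ → Matrix (Fin r) (Fin r) ℝ)
    (φ f : ℝ → Fin r → ℂ) : Prop :=
  ∀ᵐ x : ℝ, HasSum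
    (fun k : ℤ => Real.sqrt d •
      ((toComplex (Ap k)).mulVec (φ (d * x - k)) + (toComplex (Am k)).mulVec (φ (k - d * x))))
    (f x)

/-- The closed subspace `V_n` of `L²(ℝ)` spanned by the functions `φ_i(d^n x - k)` and
`φ_i(k - d^n x)`, for `i = 1, …, r` and `k ∈ ℤ`. -/
def scaleSpace {r : ℕ} (d : ℕ) (φ : ℝ → Fin r → ℂ) (n : ℤ) :
    Submodule ℂ (Lp ℂ 2 (volume : Measure ℝ)) :=
  (Submodule.span ℂ {f : Lp ℂ 2 (volume : Measure ℝ) | ∃ (i : Fin r) (k : ℤ),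
    (f =ᵐ[volume] fun x : ℝ => φ ((d : ℝ) ^ n * x - k) i) ∨
    (f =ᵐ[volume] fun x : ℝ => φ (k - (d : ℝ) ^ n * x) i)}).topologicalClosure

/-- `φ` generates a (two-direction) multiresolution approximation of `L²(ℝ)` with dilation
factor `d`. That `f ∈ V_n ↔ f(d ·) ∈ V_{n+1}` and that `V_n` is invariant under the shifts by
`d^{-n} ℤ` is built into the definition of `V_n`. -/
structure GeneratesMRA {r : ℕ} (d : ℕ) (φ : ℝ → Fin r → ℂ) : Prop where
  memLp : ∀ i, MemLp (fun x => φ x i) 2 (volume : Measure ℝ)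
  nested : ∀ n : ℤ, scaleSpace d φ n ≤ scaleSpace d φ (n + 1)
  dense : (⨆ n : ℤ, scaleSpace d φ n).topologicalClosure = ⊤
  trivial_inter : (⨅ n : ℤ, scaleSpace d φ n) = ⊥
  /-- the functions `φ_i(x - k)` and `φ_i(k - x)` form a Riesz basis of `V_0` -/
  stable : ∃ A B : ℝ, 0 < A ∧ 0 < B ∧ ∀ cp cm : Fin r × ℤ →₀ ℂ,
    A * ((cp.sum fun _ a => ‖a‖ ^ 2) + cm.sum fun _ a => ‖a‖ ^ 2) ≤
      (∫ x : ℝ, ‖(cp.sum fun p a => a * φ (x - p.2) p.1) +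
        cm.sum fun p a => a * φ (p.2 - x) p.1‖ ^ 2) ∧
    (∫ x : ℝ, ‖(cp.sum fun p a => a * φ (x - p.2) p.1) +
        cm.sum fun p a => a * φ (p.2 - x) p.1‖ ^ 2) ≤
      B * ((cp.sum fun _ a => ‖a‖ ^ 2) + cm.sum fun _ a => ‖a‖ ^ 2)

/-- `φ` is a two-direction multiscaling function of multiplicity `r` and dilation factor `d`
with the recursion coefficients `P_k^+`, `P_k^-`. -/
structure IsMultiscaling {r : ℕ} (d : ℕ) (Pp Pm : ℤ → Matrix (Fin r) (Fin r) ℝ)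
    (φ : ℝ → Fin r → ℂ) : Prop where
  refinement : IsTwoDirectionSeries d Pp Pm φ φ
  generates : GeneratesMRA d φ

/-- Orthogonality of a two-direction multiscaling function. -/
structure IsOrthogonal {r : ℕ} (φ : ℝ → Fin r → ℂ) : Prop where
  same : ∀ j k : ℤ,
    innerMat (fun x => φ (x - j)) (fun x => φ (x - k)) = if j = k then 1 else 0
  opposite : ∀ j k : ℤ, innerMat (fun x => φ (x - j)) (fun x => φ (k - x)) = 0

/-- Condition E: 1 is an (algebraically) simple eigenvalue, and all other eigenvalues are smaller
than 1 in absolute value. -/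
def ConditionE {n : Type*} [Fintype n] [DecidableEq n] (A : Matrix n n ℂ) : Prop :=
  A.charpoly.rootMultiplicity 1 = 1 ∧
    ∀ μ : ℂ, Module.End.HasEigenvalue (Matrix.toLin' A) μ → μ ≠ 1 → ‖μ‖ < 1

/-- The doubled function `[φ(x), φ(-x)]^T`. -/
def doubled {r : ℕ} (φ : ℝ → Fin r → ℂ) (x : ℝ) : Fin r ⊕ Fin r → ℂ :=
  Sum.elim (φ x) (φ (-x))

/-- The `k`-th term `k^j [[A_k^+, A_k^-], [A_{-k}^-, A_{-k}^+]]` of the series for the `j`-th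
discrete moment. -/
def discreteMomentTerm {r : ℕ} (Ap Am : ℤ → Matrix (Fin r) (Fin r) ℝ) (j : ℕ) (k : ℤ) :
    Matrix (Fin r ⊕ Fin r) (Fin r ⊕ Fin r) ℝ :=
  (k : ℝ) ^ j • Matrix.fromBlocks (Ap k) (Am k) (Am (-k)) (Ap (-k))

/-- The `j`-th discrete moment
`d^{-1/2} ∑_k k^j [[A_k^+, A_k^-], [A_{-k}^-, A_{-k}^+]]` of the doubled function, as a complex
matrix. -/
def discreteMoment {r : ℕ} (d : ℕ) (Ap Am : ℤ → Matrix (Fin r) (Fin r) ℝ) (j : ℕ) :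
    Matrix (Fin r ⊕ Fin r) (Fin r ⊕ Fin r) ℂ :=
  toComplex ((1 / Real.sqrt d) • ∑' k : ℤ, discreteMomentTerm Ap Am j k)

/-- The `j`-th continuous moment `∫ x^j f(x) dx`. -/
def continuousMoment {ι : Type*} [Fintype ι] (f : ℝ → ι → ℂ) (j : ℕ) : ι → ℂ :=
  ∫ x : ℝ, (x ^ j) • f x

/-- The upper half of a vector of size `2r`. -/
def upperHalf {r : ℕ} (v : Fin r ⊕ Fin r → ℂ) : Fin r → ℂ := fun i => v (Sum.inl i)

end

end TwoDirection

open TwoDirection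

namespace TwoDirection

open scoped InnerProductSpace

/-! Doubling turns the two-direction relation into an ordinary one: `doubled φ` satisfies a
refinement equation in `d x - k` alone, with coefficients `blockCoeff`, and orthogonality of `φ`
says exactly that the integer translates of its `2r` components are orthonormal.

Orthonormality recovers each coefficient of a dilated series `F` as an integral of `F` against
`Φ_b(d x - k)`. That function lives where `|k| ≤ d|x| + R`, and only boundedly many translates
overlap, so integrability of `x^j F` forces absolute convergence of the discrete moments up to order
`j` (`summable_coeff`). Sum and integral may then be exchanged, and expanding `((y + k)/d)^j` gives
the moment formula (`integral_pow_mul_eq`). It serves `φ` and the multiwavelets alike. For `φ`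
itself, `j = 0` is the fixed-point equation, and isolating the top term gives the recursion, since
Condition E keeps `d^j` off the spectrum of `M_0`. Condition E also makes the fixed space of `M_0` a
line.

The normalization comes from testing against the indicator of `[0, 1]` at scale `N = d^n`. Its
coefficients are `N^{-1/2}` times integrals of `Φ_b` (up to conjugation) over intervals of length
`N`: full integrals for all but `O(R)` relevant translates. Bessel's inequality bounds `∑_b |∫
Φ_b|²` above by `1` in the limit, and density of the union of the `V_n` bounds it below
(`sum_norm_sq_integral_eq_one`). -/

/-- A finite family of continuous functions supported in `[-R, R]` whose integer translates are
orthonormal. -/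
structure OrthonormalShifts {ι : Type*} (Φ : ι → ℝ → ℂ) (R : ℕ) : Prop where
  continuous : ∀ b, Continuous (Φ b)
  eq_zero : ∀ b y, (R : ℝ) < |y| → Φ b y = 0
  orthogonal : ∀ b c, ∀ k l : ℤ, b ≠ c ∨ k ≠ l →
    ∫ x : ℝ, Φ b (x - k) * star (Φ c (x - l)) = 0
  normalized : ∀ b, ∀ k : ℤ, ∫ x : ℝ, Φ b (x - k) * star (Φ b (x - k)) = 1

theorem integral_comp_mul_sub_const {E : Type*} [NormedAddCommGroup E] [NormedSpace ℝ E]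
    (g : ℝ → E) {c : ℝ} (hc : 0 < c) (t : ℝ) :
    ∫ x : ℝ, g (c * x - t) = c⁻¹ • ∫ y : ℝ, g y := by
  rw [Measure.integral_comp_mul_left (fun y => g (y - t)) c, integral_sub_right_eq_self,
    abs_of_pos (inv_pos.2 hc)]

/-! ### Dilated translates: supports, orthogonality, overlap and moments -/

namespace OrthonormalShifts

variable {ι : Type*} {Φ : ι → ℝ → ℂ} {R : ℕ}

theorem hasCompactSupport (h : OrthonormalShifts Φ R) (b : ι) : HasCompactSupport (Φ b) := by
  refine HasCompactSupport.intro (isCompact_Icc (a := -(R : ℝ)) (b := R)) fun x hx => ?_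
  refine h.eq_zero b x ?_
  by_contra hlt
  exact hx (abs_le.1 (not_lt.1 hlt))

theorem hasCompactSupport_dilate (h : OrthonormalShifts Φ R) (b : ι) {c : ℝ} (hc : 0 < c)
    (t : ℝ) : HasCompactSupport fun x : ℝ => Φ b (c * x - t) := by
  refine HasCompactSupport.intro (isCompact_Icc (a := (t - R) / c) (b := (t + R) / c))
    fun x hx => h.eq_zero b _ ?_
  by_contra hlt
  obtain ⟨h1, h2⟩ := abs_le.1 (not_lt.1 hlt)
  refine hx ⟨?_, ?_⟩
  · rw [div_le_iff₀ hc]; linarith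
  · rw [le_div_iff₀ hc]; linarith

theorem continuous_dilate (h : OrthonormalShifts Φ R) (b : ι) (c t : ℝ) :
    Continuous fun x : ℝ => Φ b (c * x - t) :=
  (h.continuous b).comp (by fun_prop)

theorem integrable_mul_dilate (h : OrthonormalShifts Φ R) (b : ι) {c : ℝ} (hc : 0 < c) (t : ℝ)
    {g : ℝ → ℂ} (hg : Continuous g) : Integrable fun x : ℝ => g x * Φ b (c * x - t) :=
  (hg.mul (h.continuous_dilate b c t)).integrable_of_hasCompactSupport
    ((h.hasCompactSupport_dilate b hc t).mul_left)

theorem integral_dilate_of_ne (h : OrthonormalShifts Φ R) {c : ℝ} (hc : 0 < c) {a b : ι}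
    {k l : ℤ} (hne : a ≠ b ∨ k ≠ l) :
    ∫ x : ℝ, Φ a (c * x - k) * star (Φ b (c * x - l)) = 0 := by
  have := integral_comp_mul_sub_const
    (fun y => Φ a (y - k) * star (Φ b (y - l))) hc 0
  simp only [sub_zero] at this
  rw [this, h.orthogonal a b k l hne, smul_zero]

theorem integral_dilate_self (h : OrthonormalShifts Φ R) {c : ℝ} (hc : 0 < c) (a : ι) (k : ℤ) :
    ∫ x : ℝ, Φ a (c * x - k) * star (Φ a (c * x - k)) = (c : ℂ)⁻¹ := by
  have := integral_comp_mul_sub_const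
    (fun y => Φ a (y - k) * star (Φ a (y - k))) hc 0
  simp only [sub_zero] at this
  rw [this, h.normalized a k]
  simp

theorem exists_norm_le (h : OrthonormalShifts Φ R) (b : ι) : ∃ C, 0 ≤ C ∧ ∀ y, ‖Φ b y‖ ≤ C := by
  obtain ⟨C, hC⟩ := (h.hasCompactSupport b).exists_bound_of_continuous (h.continuous b)
  exact ⟨C, (norm_nonneg _).trans (hC 0), hC⟩

/-- The translates of a compactly supported function overlap boundedly. -/
theorem exists_sum_norm_le (h : OrthonormalShifts Φ R) (b : ι) :
    ∃ B, 0 ≤ B ∧ ∀ (s : Finset ℤ) (y : ℝ), ∑ k ∈ s, ‖Φ b (y - k)‖ ≤ B := by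
  classical
  obtain ⟨C, hC0, hC⟩ := h.exists_norm_le b
  -- The terms vanish unless `k` lies in `[y - R, y + R]`, which contains at most `2R + 1` integers.
  refine ⟨(2 * R + 1) * C, by positivity, fun s y => ?_⟩
  set T : Finset ℤ := Finset.Icc ⌈y - R⌉ ⌊y + R⌋
  have hT : (T.card : ℝ) ≤ 2 * R + 1 := by
    rw [Int.card_Icc]
    have h1 : ((⌊y + R⌋ + 1 - ⌈y - R⌉ : ℤ) : ℝ) ≤ 2 * R + 1 := by
      push_cast
      linarith [Int.floor_le (y + R), Int.le_ceil (y - R)]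
    have h2 : ((((⌊y + R⌋ + 1 - ⌈y - R⌉).toNat : ℕ) : ℤ) : ℝ) ≤ 2 * R + 1 := by
      rw [Int.toNat_eq_max]
      push_cast at h1 ⊢
      exact max_le h1 (by positivity)
    exact_mod_cast h2
  calc ∑ k ∈ s, ‖Φ b (y - k)‖ = ∑ k ∈ s ∩ T, ‖Φ b (y - k)‖ := by
        symm
        refine Finset.sum_subset Finset.inter_subset_left fun k hk hkT => ?_
        rw [h.eq_zero b, norm_zero]
        by_contra hlt
        obtain ⟨h1, h2⟩ := abs_le.1 (not_lt.1 hlt)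
        refine hkT (Finset.mem_inter.2 ⟨hk, Finset.mem_Icc.2 ⟨?_, ?_⟩⟩)
        · rw [Int.ceil_le]; linarith
        · rw [Int.le_floor]; linarith
    _ ≤ ∑ k ∈ s ∩ T, C := Finset.sum_le_sum fun k _ => hC _
    _ = ((s ∩ T).card : ℝ) * C := by simp
    _ ≤ (2 * R + 1) * C := by
        gcongr
        exact le_trans (by exact_mod_cast Finset.card_le_card Finset.inter_subset_right) hT

variable {d : ℕ}

/-- The moments of a dilated translate of `Φ_b`. -/
theorem integral_pow_dilate (h : OrthonormalShifts Φ R) (hd : 0 < d) (j : ℕ) (k : ℤ) (b : ι) :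
    ∫ x : ℝ, ((x : ℂ) ^ j) * Φ b (d * x - k) =
      ((d : ℂ) ^ j)⁻¹ * (d : ℂ)⁻¹ * ∑ l ∈ Finset.range (j + 1),
        (j.choose l : ℂ) * ((k : ℂ) ^ (j - l) * ∫ y : ℝ, (y : ℂ) ^ l * Φ b y) := by
  have hd' : (0 : ℝ) < d := Nat.cast_pos.2 hd
  have hdc : (d : ℂ) ≠ 0 := by exact_mod_cast hd.ne'
  -- The weight `((y + k)/d)^j` becomes `x^j` under `y = d x - k`; the binomial theorem then
  -- separates `k` from `y`.
  have h1 := integral_comp_mul_sub_const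
    (fun y : ℝ => ((((y + k) / d : ℝ) : ℂ) ^ j) * Φ b y) hd' k
  have h2 : ∀ x : ℝ, ((d * x - k + k) / d : ℝ) = x := fun x => by field_simp; ring
  simp only [h2] at h1
  have hint : ∀ l, Integrable fun y : ℝ => (y : ℂ) ^ l * Φ b y := fun l => by
    have := h.integrable_mul_dilate b one_pos 0
      (g := fun y : ℝ => (y : ℂ) ^ l) (by fun_prop)
    simpa using this
  have h3 : ∀ y : ℝ, ((((y + k) / d : ℝ) : ℂ) ^ j) * Φ b y = ((d : ℂ) ^ j)⁻¹ *
      ∑ l ∈ Finset.range (j + 1), (j.choose l : ℂ) * ((k : ℂ) ^ (j - l) *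
        ((y : ℂ) ^ l * Φ b y)) := fun y => by
    push_cast
    rw [div_pow, add_pow, div_mul_eq_mul_div, Finset.sum_mul, div_eq_inv_mul]
    congr 1
    exact Finset.sum_congr rfl fun l _ => by ring
  rw [h1]
  simp only [h3]
  rw [integral_const_mul, integral_finsetSum _ fun l _ => ((hint l).const_mul _).const_mul _]
  simp only [integral_const_mul]
  rw [Complex.real_smul]
  push_cast
  ring

/-- Where `Φ_b(d x - k)` is nonzero, `|x| ≤ R + |k| ≤ (R + 1)(1 + |k|)`. This growth in `k` matches
the weight in `summable_coeff`, which allows termwise integration in `integral_pow_mul_eq`. -/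
theorem exists_integral_norm_pow_dilate_le (h : OrthonormalShifts Φ R) (hd : 0 < d) (j : ℕ)
    (b : ι) : ∃ C, 0 ≤ C ∧ ∀ k : ℤ, ∫ x : ℝ, ‖(x : ℂ) ^ j * Φ b (d * x - k)‖ ≤
      C * (1 + |(k : ℝ)|) ^ j := by
  have hd' : (0 : ℝ) < d := Nat.cast_pos.2 hd
  have hd1 : (1 : ℝ) ≤ d := by exact_mod_cast hd
  refine ⟨(R + 1) ^ j * ∫ y : ℝ, ‖Φ b y‖, by positivity, fun k => ?_⟩
  have hi : Integrable fun x : ℝ => ‖Φ b (d * x - k)‖ := by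
    simpa using (h.integrable_mul_dilate b hd' k (g := fun _ => 1) continuous_const).norm
  have hle : ∫ x : ℝ, ‖Φ b (d * x - k)‖ ≤ ∫ y : ℝ, ‖Φ b y‖ := by
    rw [integral_comp_mul_sub_const (fun y => ‖Φ b y‖) hd' k, smul_eq_mul]
    exact mul_le_of_le_one_left (by positivity) (inv_le_one_of_one_le₀ hd1)
  calc ∫ x : ℝ, ‖(x : ℂ) ^ j * Φ b (d * x - k)‖
      ≤ ∫ x : ℝ, ((R + 1) * (1 + |(k : ℝ)|)) ^ j * ‖Φ b (d * x - k)‖ := by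
        refine integral_mono_of_nonneg (Filter.Eventually.of_forall fun x => norm_nonneg _)
          (hi.const_mul _) (Filter.Eventually.of_forall fun x => ?_)
        simp only [norm_mul, norm_pow, Complex.norm_real, Real.norm_eq_abs]
        by_cases hx : (R : ℝ) < |d * x - k|
        · rw [h.eq_zero b _ hx]; simp
        · gcongr
          have h1 : |x| ≤ d * |x| := le_mul_of_one_le_left (abs_nonneg x) hd1
          have h2 : d * |x| ≤ R + |(k : ℝ)| := by
            have h3 := abs_add_le (d * x - k : ℝ) k
            rw [sub_add_cancel, abs_mul, abs_of_pos hd'] at h3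
            linarith [not_lt.1 hx]
          nlinarith [abs_nonneg (k : ℝ), (Nat.cast_nonneg R : (0 : ℝ) ≤ R)]
    _ = (R + 1) ^ j * (1 + |(k : ℝ)|) ^ j * ∫ x : ℝ, ‖Φ b (d * x - k)‖ := by
        rw [integral_const_mul, mul_pow]
    _ ≤ (R + 1) ^ j * (1 + |(k : ℝ)|) ^ j * ∫ y : ℝ, ‖Φ b y‖ := by gcongr
    _ = _ := by ring

/-! ### Dilated series: coefficients and moments -/

variable [Fintype ι] {α : ℤ → ι → ℂ} {F : ℝ → ℂ}

/-- `F(x) = √d ∑_k ∑_b α_k(b) Φ_b(d x - k)` almost everywhere. -/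
def _root_.TwoDirection.IsDilatedSeries (d : ℕ) (Φ : ι → ℝ → ℂ) (α : ℤ → ι → ℂ) (F : ℝ → ℂ) :
    Prop :=
  ∀ᵐ x : ℝ, HasSum (fun k : ℤ => (Real.sqrt d : ℂ) * ∑ b, α k b * Φ b (d * x - k)) (F x)

theorem continuous_term (h : OrthonormalShifts Φ R) (k : ℤ) :
    Continuous fun x : ℝ => (Real.sqrt d : ℂ) * ∑ b, α k b * Φ b (d * x - k) :=
  continuous_const.mul (continuous_finsetSum _ fun b _ =>
    continuous_const.mul (h.continuous_dilate b d k))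

theorem aestronglyMeasurable (h : OrthonormalShifts Φ R) (hF : IsDilatedSeries d Φ α F) :
    AEStronglyMeasurable F := by
  refine aestronglyMeasurable_of_tendsto_ae (Filter.atTop : Filter (Finset ℤ))
    (f := fun s x => ∑ k ∈ s, (Real.sqrt d : ℂ) * ∑ b, α k b * Φ b (d * x - k))
    (fun s => (continuous_finsetSum _ fun k _ => h.continuous_term k).aestronglyMeasurable) ?_
  filter_upwards [hF] with x hx
  simpa [HasSum] using hx

/-- On a bounded set only finitely many terms of a dilated series contribute. -/
theorem eq_sum_of_hasSum (h : OrthonormalShifts Φ R) {x X : ℝ} (hX : |x| ≤ X) {z : ℂ}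
    (hz : HasSum (fun k : ℤ => (Real.sqrt d : ℂ) * ∑ b, α k b * Φ b (d * x - k)) z) :
    z = ∑ k ∈ Finset.Icc (-⌈d * X + R⌉) ⌈d * X + R⌉,
      (Real.sqrt d : ℂ) * ∑ b, α k b * Φ b (d * x - k) := by
  refine hz.unique (hasSum_sum_of_ne_finset_zero fun k hk => ?_)
  have : ∀ b, Φ b (d * x - k) = 0 := fun b => h.eq_zero b _ <| by
    by_contra hlt
    obtain ⟨h1, h2⟩ := abs_le.1 (not_lt.1 hlt)
    obtain ⟨h3, h4⟩ := abs_le.1 hX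
    have hd : (0 : ℝ) ≤ d := Nat.cast_nonneg d
    have h5 := mul_le_mul_of_nonneg_left h3 hd
    have h6 := mul_le_mul_of_nonneg_left h4 hd
    have h7 := Int.le_ceil ((d : ℝ) * X + R)
    refine hk (Finset.mem_Icc.2 ⟨?_, ?_⟩)
    · have : (-⌈(d : ℝ) * X + R⌉ : ℝ) ≤ k := by linarith
      exact_mod_cast this
    · have : (k : ℝ) ≤ ⌈(d : ℝ) * X + R⌉ := by linarith
      exact_mod_cast this
  simp [this]

theorem integrableOn_Icc (h : OrthonormalShifts Φ R) (hF : IsDilatedSeries d Φ α F) (X : ℝ) :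
    IntegrableOn F (Set.Icc (-X) X) := by
  have hc : Continuous fun x : ℝ => ∑ k ∈ Finset.Icc (-⌈d * X + R⌉) ⌈d * X + R⌉,
      (Real.sqrt d : ℂ) * ∑ b, α k b * Φ b (d * x - k) :=
    continuous_finsetSum _ fun k _ => h.continuous_term k
  refine (hc.continuousOn.integrableOn_compact isCompact_Icc).congr_fun_ae ?_
  filter_upwards [ae_restrict_of_ae hF, ae_restrict_mem measurableSet_Icc] with x hx hxX
  exact (h.eq_sum_of_hasSum (abs_le.2 hxX) hx).symm

/-- The coefficients of a dilated series are recovered by integrating against the basis. -/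
theorem integral_mul_star_eq_coeff (h : OrthonormalShifts Φ R) (hd : 0 < d)
    (hF : IsDilatedSeries d Φ α F) (k : ℤ) (b : ι) :
    ∫ x : ℝ, F x * star (Φ b (d * x - k)) = (Real.sqrt d : ℂ) * (α k b * (d : ℂ)⁻¹) := by
  classical
  have hd' : (0 : ℝ) < d := Nat.cast_pos.2 hd
  -- If `Φ_b(d x - k)` and `Φ_c(d x - l)` are both nonzero at `x`, then `|k - l| ≤ 2R`; so the
  -- product with the series is a finite sum, with an index set independent of `x`.
  set S : Finset ℤ := Finset.Icc (k - 2 * R) (k + 2 * R)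
  have hae : (fun x : ℝ => F x * star (Φ b (d * x - k))) =ᵐ[volume] fun x : ℝ =>
      ∑ l ∈ S, ∑ c, (Real.sqrt d : ℂ) * (α l c * (Φ c (d * x - l) * star (Φ b (d * x - k)))) := by
    filter_upwards [hF] with x hx
    refine (hx.mul_right (star (Φ b (d * x - k)))).unique ?_
    have := hasSum_sum_of_ne_finset_zero (s := S) (L := SummationFilter.unconditional ℤ)
      (f := fun l : ℤ => ((Real.sqrt d : ℂ) * ∑ c, α l c * Φ c (d * x - l)) *
        star (Φ b (d * x - k))) ?_
    · simpa only [Finset.mul_sum, Finset.sum_mul, mul_assoc] using this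
    · intro l hl
      by_cases hk : (R : ℝ) < |d * x - k|
      · rw [h.eq_zero b _ hk]; simp
      have : ∀ c, Φ c (d * x - l) = 0 := fun c => h.eq_zero c _ <| by
        by_contra hlt
        obtain ⟨h1, h2⟩ := abs_le.1 (not_lt.1 hlt)
        obtain ⟨h3, h4⟩ := abs_le.1 (not_lt.1 hk)
        refine hl (Finset.mem_Icc.2 ⟨?_, ?_⟩)
        · have : (k : ℝ) - 2 * R ≤ l := by linarith
          exact_mod_cast this
        · have : (l : ℝ) ≤ k + 2 * R := by linarith
          exact_mod_cast this
      simp [this]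
  have hint : ∀ l : ℤ, ∀ c, Integrable fun x : ℝ =>
      Φ c (d * x - l) * star (Φ b (d * x - k)) := fun l c => by
    have := h.integrable_mul_dilate c hd' l (h.continuous_dilate b d k).star
    exact this.congr (Filter.Eventually.of_forall fun x => mul_comm _ _)
  rw [integral_congr_ae hae, integral_finsetSum _ fun l _ => integrable_finsetSum _ fun c _ =>
    ((hint l c).const_mul _).const_mul _]
  have hkS : k ∈ S := Finset.mem_Icc.2 ⟨by omega, by omega⟩
  rw [Finset.sum_eq_single_of_mem k hkS, integral_finsetSum _ fun c _ =>
    ((hint k c).const_mul _).const_mul _, Finset.sum_eq_single_of_mem b (Finset.mem_univ b)]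
  · rw [integral_const_mul, integral_const_mul, h.integral_dilate_self hd']
    simp
  · intro c _ hc
    rw [integral_const_mul, integral_const_mul, h.integral_dilate_of_ne hd' (Or.inl hc)]
    simp
  · intro l _ hl
    rw [integral_finsetSum _ fun c _ => ((hint l c).const_mul _).const_mul _]
    refine Finset.sum_eq_zero fun c _ => ?_
    rw [integral_const_mul, integral_const_mul, h.integral_dilate_of_ne hd' (Or.inr hl)]
    simp

/-- If the `j`-th moment of a dilated series exists, so do its moments of any polynomial weight of
degree `j`. -/
theorem integrable_pow_mul (h : OrthonormalShifts Φ R) (hF : IsDilatedSeries d Φ α F) {j : ℕ}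
    (hj : Integrable fun x : ℝ => (x ^ j : ℝ) • F x) {c : ℝ} (hc : 0 ≤ c) :
    Integrable fun x : ℝ => (c * (1 + |x|)) ^ j * ‖F x‖ := by
  -- The weight `x^j` gives no control near `0`, so local integrability covers `[-1, 1]`, where `1 +
  -- |x| ≤ 2`; elsewhere `1 + |x| ≤ 2|x|`.
  have hloc : Integrable fun x : ℝ => (Set.Icc (-1 : ℝ) 1).indicator (fun x => ‖F x‖) x :=
    (integrable_indicator_iff measurableSet_Icc).2 (h.integrableOn_Icc hF 1).norm
  refine ((hloc.add hj.norm).const_mul ((c * 2) ^ j)).mono'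
    (((by fun_prop : Continuous fun x : ℝ => (c * (1 + |x|)) ^ j).aestronglyMeasurable).mul
      (h.aestronglyMeasurable hF).norm) (Filter.Eventually.of_forall fun x => ?_)
  have h0 : 0 ≤ (c * (1 + |x|)) ^ j * ‖F x‖ := by positivity
  rw [Real.norm_of_nonneg h0]
  simp only [Pi.add_apply, norm_smul, norm_pow, Real.norm_eq_abs]
  by_cases hx : x ∈ Set.Icc (-1 : ℝ) 1
  · rw [Set.indicator_of_mem hx]
    have h1 : |x| ≤ 1 := abs_le.2 hx
    have h2 : 0 ≤ |x| ^ j * ‖F x‖ := by positivity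
    have h3 : (c * (1 + |x|)) ^ j ≤ (c * 2) ^ j := by gcongr; linarith
    calc (c * (1 + |x|)) ^ j * ‖F x‖ ≤ (c * 2) ^ j * ‖F x‖ := by gcongr
      _ ≤ _ := by gcongr; linarith
  · rw [Set.indicator_of_notMem hx, zero_add]
    have h1 : 1 < |x| := not_le.1 fun hle => hx (abs_le.1 hle)
    have h3 : (c * (1 + |x|)) ^ j ≤ (c * 2) ^ j * |x| ^ j := by
      rw [← mul_pow, mul_assoc]
      gcongr
      linarith
    calc (c * (1 + |x|)) ^ j * ‖F x‖ ≤ ((c * 2) ^ j * |x| ^ j) * ‖F x‖ := by gcongr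
      _ = _ := by ring

/-- If the `j`-th moment of a dilated series exists, its discrete moments of order at most `j`
converge absolutely. -/
theorem summable_coeff (h : OrthonormalShifts Φ R) (hd : 0 < d) (hF : IsDilatedSeries d Φ α F)
    {j : ℕ} (hj : Integrable fun x : ℝ => (x ^ j : ℝ) • F x) (b : ι) :
    Summable fun k : ℤ => (1 + |(k : ℝ)|) ^ j * ‖α k b‖ := by
  have hd' : (0 : ℝ) < d := Nat.cast_pos.2 hd
  obtain ⟨B, hB0, hB⟩ := h.exists_sum_norm_le b
  -- On the support of `Φ_b(d x - k)` one has `|k| ≤ d|x| + R`, hence `1 + |k| ≤ (d + R + 1)(1 +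
  -- |x|)`: the weight in `k` can be moved under the integral.
  set w : ℝ → ℝ := fun x => ((d + R + 1 : ℝ) * (1 + |x|)) ^ j * ‖F x‖
  have hw : Integrable w := h.integrable_pow_mul hF hj (by positivity)
  obtain ⟨C, hC0, hC⟩ := h.exists_norm_le b
  have hwk : ∀ k : ℤ, Integrable fun x => w x * ‖Φ b (d * x - k)‖ := fun k =>
    hw.mul_bdd (c := C) (h.continuous_dilate b d k).norm.aestronglyMeasurable
      (Filter.Eventually.of_forall fun x => by simpa using hC _)
  have key : ∀ k : ℤ, (1 + |(k : ℝ)|) ^ j * ‖α k b‖ ≤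
      Real.sqrt d * ∫ x, w x * ‖Φ b (d * x - k)‖ := fun k => by
    have hα : (α k b) = (Real.sqrt d : ℂ) * ∫ x : ℝ, F x * star (Φ b (d * x - k)) := by
      rw [h.integral_mul_star_eq_coeff hd hF]
      have h1 : (Real.sqrt d : ℂ) * Real.sqrt d = d := by
        rw [← Complex.ofReal_mul, Real.mul_self_sqrt hd'.le]; simp
      have h2 : (d : ℂ) ≠ 0 := by exact_mod_cast hd.ne'
      calc α k b = (d : ℂ) * (d : ℂ)⁻¹ * α k b := by rw [mul_inv_cancel₀ h2, one_mul]
        _ = _ := by rw [← h1]; ring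
    rw [hα, norm_mul, Complex.norm_real, Real.norm_of_nonneg (Real.sqrt_nonneg _), mul_left_comm]
    refine mul_le_mul_of_nonneg_left ?_ (Real.sqrt_nonneg _)
    refine (mul_le_mul_of_nonneg_left (norm_integral_le_integral_norm _) (by positivity)).trans ?_
    rw [← integral_const_mul]
    refine integral_mono_of_nonneg (Filter.Eventually.of_forall fun x => ?_) (hwk k)
      (Filter.Eventually.of_forall fun x => ?_)
    · simp only [Pi.zero_apply]; positivity
    · simp only [w]
      rw [norm_mul, norm_star, ← mul_assoc]
      by_cases hx : (R : ℝ) < |d * x - k|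
      · rw [h.eq_zero b _ hx]; simp
      · gcongr
        have h1 : |(k : ℝ)| ≤ d * |x| + R := by
          have h2 : (k : ℝ) = d * x - (d * x - k) := by ring
          have h3 := abs_sub (d * x : ℝ) (d * x - k)
          rw [← h2, abs_mul, abs_of_pos hd'] at h3
          linarith [not_lt.1 hx]
        nlinarith [abs_nonneg x, (Nat.cast_nonneg R : (0 : ℝ) ≤ R)]
  -- Bounded overlap bounds the sum under the integral by `B`, uniformly over finite sets of
  -- translates.
  refine summable_of_sum_le (c := Real.sqrt d * ∫ x, w x * B) (fun k => by positivity)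
    fun s => (Finset.sum_le_sum fun k _ => key k).trans ?_
  rw [← Finset.mul_sum, ← integral_finsetSum _ fun k _ => hwk k]
  refine mul_le_mul_of_nonneg_left ?_ (Real.sqrt_nonneg _)
  refine integral_mono (integrable_finsetSum _ fun k _ => hwk k) (hw.mul_const _) fun x => ?_
  simp only
  rw [← Finset.mul_sum]
  exact mul_le_mul_of_nonneg_left (hB s _) (by positivity)

theorem _root_.TwoDirection.summable_pow_mul_of_le {a : ℤ → ℂ} {i j : ℕ} (hij : i ≤ j)
    (ha : Summable fun k : ℤ => (1 + |(k : ℝ)|) ^ j * ‖a k‖) :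
    Summable fun k : ℤ => (k : ℂ) ^ i * a k := by
  refine Summable.of_norm_bounded ha fun k => ?_
  rw [norm_mul, norm_pow, Complex.norm_intCast]
  gcongr
  calc |(k : ℝ)| ^ i ≤ (1 + |(k : ℝ)|) ^ i := by gcongr; linarith
    _ ≤ _ := pow_le_pow_right₀ (by linarith [abs_nonneg (k : ℝ)]) hij

/-- The moments of a dilated series in terms of its discrete moments and the moments of `Φ`. -/
theorem integral_pow_mul_eq (h : OrthonormalShifts Φ R) (hd : 0 < d)
    (hF : IsDilatedSeries d Φ α F) {j : ℕ}
    (hα : ∀ b, Summable fun k : ℤ => (1 + |(k : ℝ)|) ^ j * ‖α k b‖) :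
    ∫ x : ℝ, (x : ℂ) ^ j * F x = ((d : ℂ) ^ j)⁻¹ * ∑ l ∈ Finset.range (j + 1),
      (j.choose l : ℂ) * ∑ b, ((Real.sqrt d : ℂ)⁻¹ * ∑' k : ℤ, (k : ℂ) ^ (j - l) * α k b) *
        ∫ y : ℝ, (y : ℂ) ^ l * Φ b y := by
  have hd' : (0 : ℝ) < d := Nat.cast_pos.2 hd
  set T : ι → ℤ → ℝ → ℂ := fun b k x => (Real.sqrt d : ℂ) * (α k b *
    ((x : ℂ) ^ j * Φ b (d * x - k)))
  have hTint : ∀ b k, Integrable (T b k) := fun b k =>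
    ((h.integrable_mul_dilate b hd' k (by fun_prop)).const_mul _).const_mul _
  have hTsum : ∀ b, Summable fun k => ∫ x, ‖T b k x‖ := fun b => by
    obtain ⟨C, hC0, hC⟩ := h.exists_integral_norm_pow_dilate_le hd j b
    refine Summable.of_nonneg_of_le (fun k => by positivity) (fun k => ?_)
      ((hα b).mul_left (Real.sqrt d * C))
    simp only [T]
    simp_rw [norm_mul (Real.sqrt d : ℂ), norm_mul (α k b)]
    rw [integral_const_mul, integral_const_mul, Complex.norm_real,
      Real.norm_of_nonneg (Real.sqrt_nonneg _)]
    calc _ ≤ Real.sqrt d * (‖α k b‖ * (C * (1 + |(k : ℝ)|) ^ j)) := by gcongr; exact hC k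
      _ = _ := by ring
  have hGint : ∀ k, Integrable fun x => ∑ b, T b k x := fun k =>
    integrable_finsetSum _ fun b _ => hTint b k
  have hGsum : Summable fun k => ∫ x, ‖∑ b, T b k x‖ := by
    refine Summable.of_nonneg_of_le (fun k => by positivity) (fun k => ?_)
      (summable_sum (s := Finset.univ) fun b _ => hTsum b)
    rw [← integral_finsetSum _ fun b _ => (hTint b k).norm]
    exact integral_mono (hGint k).norm (integrable_finsetSum _ fun b _ => (hTint b k).norm)
      fun x => norm_sum_le _ _
  have hmain := hasSum_integral_of_summable_integral_norm hGint hGsum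
  have hae : (fun x => ∑' k, ∑ b, T b k x) =ᵐ[volume] fun x : ℝ => (x : ℂ) ^ j * F x := by
    filter_upwards [hF] with x hx
    rw [← (hx.mul_left ((x : ℂ) ^ j)).tsum_eq]
    refine tsum_congr fun k => ?_
    simp only [T, Finset.mul_sum]
    exact Finset.sum_congr rfl fun b _ => by ring
  rw [integral_congr_ae hae] at hmain
  refine hmain.unique ?_
  -- The `√d` of the series and the Jacobian `1/d` combine to the `1/√d` of the discrete moments.
  have hs : (Real.sqrt d : ℂ) * (d : ℂ)⁻¹ = (Real.sqrt d : ℂ)⁻¹ := by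
    have h1 : (Real.sqrt d : ℂ) * Real.sqrt d = d := by
      rw [← Complex.ofReal_mul, Real.mul_self_sqrt hd'.le]; simp
    have h2 : (Real.sqrt d : ℂ) ≠ 0 := by exact_mod_cast (Real.sqrt_pos.2 hd').ne'
    rw [← h1]
    field_simp
  have hterm : ∀ k : ℤ, ∫ x, ∑ b, T b k x = ((d : ℂ) ^ j)⁻¹ * ∑ l ∈ Finset.range (j + 1),
      (j.choose l : ℂ) * ∑ b, ((Real.sqrt d : ℂ)⁻¹ * ((k : ℂ) ^ (j - l) * α k b)) *
        ∫ y : ℝ, (y : ℂ) ^ l * Φ b y := fun k => by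
    rw [integral_finsetSum _ fun b _ => hTint b k]
    simp only [T, integral_const_mul]
    simp only [h.integral_pow_dilate hd, Finset.mul_sum]
    rw [Finset.sum_comm]
    refine Finset.sum_congr rfl fun l _ => Finset.sum_congr rfl fun b _ => ?_
    rw [← hs]
    ring
  simp only [hterm]
  refine HasSum.mul_left _ (hasSum_sum fun l _ => HasSum.mul_left _ (hasSum_sum fun b _ =>
    HasSum.mul_right _ (HasSum.mul_left _ ?_)))
  exact (summable_pow_mul_of_le (Nat.sub_le j l) (hα b)).hasSum

end OrthonormalShifts

/-! ### Approximating the indicator of `[0, 1]` in `L²` -/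

/-- If `x` is close to the closed span of an orthonormal family, then the squares of its
coefficients almost sum to its squared norm. -/
theorem norm_sq_le_sum_inner_of_mem_closure_span {E κ : Type*} [NormedAddCommGroup E]
    [InnerProductSpace ℂ E] {v : κ → E} (hv : Orthonormal ℂ v) {x g : E}
    (hg : g ∈ (Submodule.span ℂ (Set.range v)).topologicalClosure) (S : Finset κ)
    (hS : ∀ i ∉ S, ⟪v i, x⟫_ℂ = 0) :
    ‖x‖ ^ 2 ≤ ∑ i ∈ S, ‖⟪v i, x⟫_ℂ‖ ^ 2 + ‖x - g‖ ^ 2 := by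
  classical
  -- `p` is the orthogonal projection of `x` onto the closed span, so Pythagoras makes `‖x - g‖` at
  -- least `‖x - p‖` for every `g` there.
  set p : E := ∑ i ∈ S, ⟪v i, x⟫_ℂ • v i
  have hp : p ∈ (Submodule.span ℂ (Set.range v)).topologicalClosure :=
    Submodule.le_topologicalClosure _ (Submodule.sum_mem _ fun i _ =>
      Submodule.smul_mem _ _ (Submodule.subset_span ⟨i, rfl⟩))
  have hvp : ∀ i, ⟪v i, x - p⟫_ℂ = 0 := fun i => by
    rw [inner_sub_right]
    by_cases hi : i ∈ S
    · rw [hv.inner_right_sum _ hi, sub_self]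
    · rw [hS i hi, inner_sum, zero_sub, neg_eq_zero]
      refine Finset.sum_eq_zero fun l hl => ?_
      rw [inner_smul_right, hv.inner_eq_zero (fun he : i = l => hi (he ▸ hl)), mul_zero]
  have horth : ∀ y ∈ (Submodule.span ℂ (Set.range v)).topologicalClosure, ⟪y, x - p⟫_ℂ = 0 := by
    have hle : (Submodule.span ℂ (Set.range v)).topologicalClosure ≤ (ℂ ∙ (x - p))ᗮ := by
      refine Submodule.topologicalClosure_minimal _ (Submodule.span_le.2 ?_)
        (Submodule.isClosed_orthogonal _)
      rintro _ ⟨i, rfl⟩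
      exact Submodule.mem_orthogonal_singleton_iff_inner_left.2 (hvp i)
    exact fun y hy => Submodule.mem_orthogonal_singleton_iff_inner_left.1 (hle hy)
  have hpn : ‖p‖ ^ 2 = ∑ i ∈ S, ‖⟪v i, x⟫_ℂ‖ ^ 2 := by
    have h0 := inner_self_eq_norm_sq_to_K (𝕜 := ℂ) p
    rw [hv.inner_sum] at h0
    simp only [RCLike.conj_mul] at h0
    exact Complex.ofReal_injective (by simpa using h0.symm)
  have h1 : ‖x‖ ^ 2 = ‖p‖ ^ 2 + ‖x - p‖ ^ 2 := by
    have := norm_add_sq_eq_norm_sq_add_norm_sq_of_inner_eq_zero p (x - p) (horth p hp)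
    rw [add_sub_cancel] at this
    simpa [sq] using this
  have h2 : ‖x - g‖ ^ 2 = ‖p - g‖ ^ 2 + ‖x - p‖ ^ 2 := by
    have := norm_add_sq_eq_norm_sq_add_norm_sq_of_inner_eq_zero (p - g) (x - p)
      (horth _ (Submodule.sub_mem _ hp hg))
    rw [show p - g + (x - p) = x - g by abel] at this
    simpa [sq] using this
  nlinarith [sq_nonneg ‖p - g‖]

namespace OrthonormalShifts

variable {ι : Type*} {Φ : ι → ℝ → ℂ} {R : ℕ}

theorem memLp_dilate (h : OrthonormalShifts Φ R) {c : ℝ} (hc : 0 < c) (p : ι × ℤ) :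
    MemLp (fun x : ℝ => (Real.sqrt c : ℂ) * Φ p.1 (c * x - p.2)) 2 :=
  (continuous_const.mul (h.continuous_dilate p.1 c p.2)).memLp_of_hasCompactSupport
    ((h.hasCompactSupport_dilate p.1 hc p.2).mul_left)

/-- The functions `√c Φ_b(c x - k)` as elements of `L²(ℝ)`. -/
noncomputable def dilateLp (h : OrthonormalShifts Φ R) {c : ℝ} (hc : 0 < c) (p : ι × ℤ) :
    Lp ℂ 2 (volume : Measure ℝ) :=
  (h.memLp_dilate hc p).toLp _

theorem coeFn_dilateLp (h : OrthonormalShifts Φ R) {c : ℝ} (hc : 0 < c) (p : ι × ℤ) :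
    h.dilateLp hc p =ᵐ[volume] fun x : ℝ => (Real.sqrt c : ℂ) * Φ p.1 (c * x - p.2) :=
  (h.memLp_dilate hc p).coeFn_toLp

theorem inner_dilateLp (h : OrthonormalShifts Φ R) {c : ℝ} (hc : 0 < c) (p q : ι × ℤ) :
    ⟪h.dilateLp hc p, h.dilateLp hc q⟫_ℂ =
      c * ∫ x : ℝ, Φ q.1 (c * x - q.2) * star (Φ p.1 (c * x - p.2)) := by
  have hs : (Real.sqrt c : ℂ) * Real.sqrt c = c := by
    rw [← Complex.ofReal_mul, Real.mul_self_sqrt hc.le]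
  rw [L2.inner_def, ← integral_const_mul]
  refine integral_congr_ae ?_
  filter_upwards [h.coeFn_dilateLp hc p, h.coeFn_dilateLp hc q] with x hp hq
  rw [hp, hq, RCLike.inner_apply, map_mul, Complex.conj_ofReal, ← hs]
  simp only [starRingEnd_apply]
  ring

theorem orthonormal_dilateLp (h : OrthonormalShifts Φ R) {c : ℝ} (hc : 0 < c) :
    Orthonormal ℂ (h.dilateLp hc) := by
  refine ⟨fun p => ?_, fun p q hpq => ?_⟩
  · have h1 := inner_self_eq_norm_sq_to_K (𝕜 := ℂ) (h.dilateLp hc p)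
    rw [h.inner_dilateLp, h.integral_dilate_self hc, mul_inv_cancel₀ (by exact_mod_cast hc.ne')]
      at h1
    have h2 : ‖h.dilateLp hc p‖ ^ 2 = 1 := Complex.ofReal_injective (by simpa using h1.symm)
    exact (pow_eq_one_iff_of_nonneg (norm_nonneg _) two_ne_zero).1 h2
  · change ⟪h.dilateLp hc p, h.dilateLp hc q⟫_ℂ = 0
    rw [h.inner_dilateLp, h.integral_dilate_of_ne hc, mul_zero]
    by_contra hne
    push Not at hne
    exact hpq (Prod.ext hne.1.symm hne.2.symm)

/-- The indicator function of `[0, 1]` in `L²(ℝ)`. -/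
noncomputable def _root_.TwoDirection.unitIndicator : Lp ℂ 2 (volume : Measure ℝ) :=
  indicatorConstLp 2 (measurableSet_Icc (a := (0 : ℝ)) (b := 1)) (by simp) (1 : ℂ)

theorem _root_.TwoDirection.norm_unitIndicator : ‖unitIndicator‖ = 1 := by
  rw [unitIndicator, norm_indicatorConstLp (by simp) (by simp)]
  simp

/-- The substitution `y = c x - k` carries `[0, 1]` to `[-k, c - k]`, and `(√c / c)² = 1/c`. -/
theorem norm_sq_inner_unitIndicator (h : OrthonormalShifts Φ R) {c : ℝ} (hc : 0 < c)
    (p : ι × ℤ) : ‖⟪h.dilateLp hc p, unitIndicator⟫_ℂ‖ ^ 2 =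
      c⁻¹ * ‖∫ y in (-p.2 : ℝ)..(c - p.2), Φ p.1 y‖ ^ 2 := by
  rw [norm_inner_symm, unitIndicator, L2.inner_indicatorConstLp_one,
    setIntegral_congr_ae measurableSet_Icc
      ((h.coeFn_dilateLp hc p).mono fun x hx _ => hx), integral_const_mul,
    integral_Icc_eq_integral_Ioc, ← intervalIntegral.integral_of_le zero_le_one,
    intervalIntegral.integral_comp_mul_sub _ hc.ne', norm_mul, norm_smul, mul_pow, mul_pow,
    Complex.norm_real, Real.norm_of_nonneg (Real.sqrt_nonneg _), Real.sq_sqrt hc.le,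
    Real.norm_of_nonneg (inv_pos.2 hc).le, mul_zero, mul_one, zero_sub]
  field_simp

theorem integrable (h : OrthonormalShifts Φ R) (b : ι) : Integrable (Φ b) :=
  (h.continuous b).integrable_of_hasCompactSupport (h.hasCompactSupport b)

theorem intervalIntegral_eq (h : OrthonormalShifts Φ R) (b : ι) {s t : ℝ} (hs : s ≤ -R)
    (ht : R ≤ t) : ∫ y in s..t, Φ b y = ∫ y, Φ b y := by
  have hst : s ≤ t := by linarith [(Nat.cast_nonneg R : (0 : ℝ) ≤ R)]
  rw [intervalIntegral.integral_of_le hst, ← integral_Icc_eq_integral_Ioc]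
  refine setIntegral_eq_integral_of_forall_compl_eq_zero fun x hx => h.eq_zero b x ?_
  by_contra hlt
  obtain ⟨h1, h2⟩ := abs_le.1 (not_lt.1 hlt)
  exact hx ⟨by linarith, by linarith⟩

theorem norm_intervalIntegral_le (h : OrthonormalShifts Φ R) (b : ι) (s t : ℝ) :
    ‖∫ y in s..t, Φ b y‖ ≤ ∫ y, ‖Φ b y‖ :=
  (intervalIntegral.norm_integral_le_integral_norm_uIoc).trans
    (setIntegral_le_integral (h.integrable b).norm
      (Filter.Eventually.of_forall fun _ => norm_nonneg _))

theorem intervalIntegral_eq_zero (h : OrthonormalShifts Φ R) (b : ι) {s t : ℝ}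
    (hst : (R < s ∧ R < t) ∨ (s < -R ∧ t < -R)) : ∫ y in s..t, Φ b y = 0 := by
  have : ∀ y ∈ Set.uIcc s t, Φ b y = 0 := fun y hy => h.eq_zero b y <| by
    rcases hst with ⟨h1, h2⟩ | ⟨h1, h2⟩
    · exact lt_of_lt_of_le (lt_of_lt_of_le (lt_min h1 h2) hy.1) (le_abs_self y)
    · exact lt_of_lt_of_le (by linarith [hy.2, max_lt h1 h2]) (neg_le_abs y)
  rw [intervalIntegral.integral_congr (g := fun _ => 0) this]
  simp

variable [Fintype ι]

/-- Bessel's inequality restricted to the `N - 2R` shifts `R ≤ k < N - R`, for which `[-k, N - k]`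
contains `[-R, R]` and the coefficient sees the full integral. -/
theorem sum_norm_sq_integral_le (h : OrthonormalShifts Φ R) {N : ℕ} (hN : 0 < N)
    (hNR : 2 * R ≤ N) : ((N : ℝ) - 2 * R) * ∑ b, ‖∫ y, Φ b y‖ ^ 2 ≤ N := by
  have hN' : (0 : ℝ) < N := Nat.cast_pos.2 hN
  have hB := (h.orthonormal_dilateLp hN').sum_inner_products_le unitIndicator
    (s := Finset.univ ×ˢ Finset.Ico (R : ℤ) (N - R))
  have hterm : ∀ p ∈ Finset.univ ×ˢ Finset.Ico (R : ℤ) (N - R),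
      ‖⟪h.dilateLp hN' p, unitIndicator⟫_ℂ‖ ^ 2 = (N : ℝ)⁻¹ * ‖∫ y, Φ p.1 y‖ ^ 2 := by
    rintro ⟨b, k⟩ hp
    obtain ⟨h1, h2⟩ := Finset.mem_Ico.1 (Finset.mem_product.1 hp).2
    have h1' : (R : ℝ) ≤ k := by exact_mod_cast h1
    have h2' : (k : ℝ) < N - R := by exact_mod_cast h2
    rw [h.norm_sq_inner_unitIndicator, h.intervalIntegral_eq b] <;> simp only <;> linarith
  have hcard : ((Finset.Ico (R : ℤ) (N - R)).card : ℝ) = N - 2 * R := by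
    rw [Int.card_Ico]
    have : (((N - R - R : ℤ).toNat : ℤ) : ℝ) = N - 2 * R := by
      rw [Int.toNat_of_nonneg (by omega)]; push_cast; ring
    exact_mod_cast this
  rw [Finset.sum_congr rfl hterm, norm_unitIndicator, Finset.sum_product_right] at hB
  simp only [Finset.sum_const, nsmul_eq_mul, hcard, ← Finset.mul_sum] at hB
  rw [← mul_assoc, mul_comm _ ((N : ℝ)⁻¹), mul_assoc, inv_mul_le_iff₀ hN'] at hB
  linarith

/-- The converse estimate: only `-R ≤ k ≤ N + R` contribute, and partial integrals occur only for
boundedly many `k` near the two ends, so the error is `O(1)` against the main term of order `N`. -/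
theorem le_sum_norm_sq_integral (h : OrthonormalShifts Φ R) {N : ℕ} (hN' : (0 : ℝ) < N)
    (hNR : 2 * R ≤ N) {g : Lp ℂ 2 (volume : Measure ℝ)}
    (hg : g ∈ (Submodule.span ℂ (Set.range (h.dilateLp hN'))).topologicalClosure) :
    (N : ℝ) * (1 - ‖unitIndicator - g‖ ^ 2) ≤ (N + 2 * R + 1) * ∑ b, ‖∫ y, Φ b y‖ ^ 2 +
      (4 * R + 1) * ∑ b, (∫ y, ‖Φ b y‖) ^ 2 := by
  classical
  set S : Finset (ι × ℤ) := Finset.univ ×ˢ Finset.Icc (-(R : ℤ)) (N + R)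
  have hP := norm_sq_le_sum_inner_of_mem_closure_span (x := unitIndicator)
    (h.orthonormal_dilateLp hN') hg S (fun p hp => by
      have hsq := h.norm_sq_inner_unitIndicator hN' p
      rw [h.intervalIntegral_eq_zero] at hsq
      · simpa using hsq
      by_contra hne
      push Not at hne
      refine hp (Finset.mem_product.2 ⟨Finset.mem_univ _, Finset.mem_Icc.2 ⟨?_, ?_⟩⟩)
      · by_contra hlt
        have : (p.2 : ℝ) < -R := by exact_mod_cast not_le.1 hlt
        linarith [hne.1 (by linarith)]
      · by_contra hlt
        have : (N + R : ℝ) < p.2 := by exact_mod_cast not_le.1 hlt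
        linarith [hne.2 (by linarith)])
  -- The shifts whose interval may cut the support: `2R` at one end and `2R + 1` at the other.
  set U : Finset ℤ := Finset.Ico (-(R : ℤ)) R ∪ Finset.Icc (N - R : ℤ) (N + R)
  have hterm : ∀ p ∈ S, ‖⟪h.dilateLp hN' p, unitIndicator⟫_ℂ‖ ^ 2 ≤
      (N : ℝ)⁻¹ * (‖∫ y, Φ p.1 y‖ ^ 2 + if p.2 ∈ U then (∫ y, ‖Φ p.1 y‖) ^ 2 else 0) := by
    rintro ⟨b, k⟩ hp
    obtain ⟨h1, h2⟩ := Finset.mem_Icc.1 (Finset.mem_product.1 hp).2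
    rw [h.norm_sq_inner_unitIndicator]
    refine mul_le_mul_of_nonneg_left ?_ (by positivity)
    simp only
    split_ifs with hk
    · refine le_add_of_nonneg_of_le (by positivity) ?_
      gcongr
      exact h.norm_intervalIntegral_le b _ _
    · have h3 : (R : ℤ) ≤ k := by
        by_contra hlt
        exact hk (Finset.mem_union_left _ (Finset.mem_Ico.2 ⟨h1, not_le.1 hlt⟩))
      have h4 : k < N - R := by
        by_contra hlt
        exact hk (Finset.mem_union_right _ (Finset.mem_Icc.2 ⟨not_lt.1 hlt, h2⟩))
      have h3' : (R : ℝ) ≤ k := by exact_mod_cast h3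
      have h4' : (k : ℝ) < N - R := by exact_mod_cast h4
      rw [h.intervalIntegral_eq b (by linarith) (by linarith), add_zero]
  have hcard : ((Finset.Icc (-(R : ℤ)) (N + R)).card : ℝ) = N + 2 * R + 1 := by
    rw [Int.card_Icc]
    have : (((N + R + 1 - -R : ℤ).toNat : ℤ) : ℝ) = N + 2 * R + 1 := by
      rw [Int.toNat_of_nonneg (by omega)]; push_cast; ring
    exact_mod_cast this
  have hU : (U.card : ℝ) ≤ 4 * R + 1 := by
    have h1 : U.card ≤ 4 * R + 1 := by
      refine (Finset.card_union_le _ _).trans ?_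
      rw [Int.card_Ico, Int.card_Icc]
      omega
    exact_mod_cast h1
  have hsum : ∑ p ∈ S, (N : ℝ)⁻¹ *
      (‖∫ y, Φ p.1 y‖ ^ 2 + if p.2 ∈ U then (∫ y, ‖Φ p.1 y‖) ^ 2 else 0) ≤
      (N : ℝ)⁻¹ * ((N + 2 * R + 1) * ∑ b, ‖∫ y, Φ b y‖ ^ 2 +
      (4 * R + 1) * ∑ b, (∫ y, ‖Φ b y‖) ^ 2) := by
    rw [← Finset.mul_sum]
    refine mul_le_mul_of_nonneg_left ?_ (by positivity)
    rw [Finset.sum_add_distrib, Finset.sum_product_right, Finset.sum_product]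
    refine add_le_add (by simp only [Finset.sum_const, nsmul_eq_mul, hcard, le_refl]) ?_
    rw [Finset.mul_sum]
    refine Finset.sum_le_sum fun b _ => ?_
    simp only
    rw [← Finset.sum_filter, Finset.sum_const, nsmul_eq_mul]
    refine mul_le_mul_of_nonneg_right (le_trans ?_ hU) (by positivity)
    exact_mod_cast Finset.card_le_card fun k hk => (Finset.mem_filter.1 hk).2
  have hfin := hP.trans (add_le_add_left ((Finset.sum_le_sum hterm).trans hsum) _)
  rw [norm_unitIndicator] at hfin
  have h5 := mul_le_mul_of_nonneg_left hfin hN'.le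
  rw [mul_add, ← mul_assoc, mul_inv_cancel₀ hN'.ne'] at h5
  linarith

/-- If the spans of the dilated translates approximate the indicator function of `[0, 1]`, then
the vector of integrals of `Φ` is a unit vector. -/
theorem sum_norm_sq_integral_eq_one (h : OrthonormalShifts Φ R)
    (hdense : ∀ ε > 0, ∀ N₀ : ℕ, ∃ N ≥ N₀, ∃ hN : (0 : ℝ) < N,
      ∃ g ∈ (Submodule.span ℂ (Set.range (h.dilateLp hN))).topologicalClosure,
        ‖unitIndicator - g‖ < ε) :
    ∑ b, ‖∫ y, Φ b y‖ ^ 2 = 1 := by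
  set m := ∑ b, ‖∫ y, Φ b y‖ ^ 2
  set K := ∑ b, (∫ y, ‖Φ b y‖) ^ 2
  refine le_antisymm (not_lt.1 fun hlt => ?_) (not_lt.1 fun hlt => ?_)
  -- At scale `N + 2R + 1` the upper estimate reads `(N + 1) m ≤ N + 2R + 1`, which fails for large
  -- `N` if `m > 1`.
  · obtain ⟨N, hN⟩ := exists_nat_gt (2 * R * m / (m - 1))
    rw [div_lt_iff₀ (by linarith)] at hN
    have h1 := h.sum_norm_sq_integral_le (N := N + 2 * R + 1) (by omega) (by omega)
    push_cast at h1
    change ((N : ℝ) + 2 * R + 1 - 2 * R) * m ≤ N + 2 * R + 1 at h1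
    nlinarith [(Nat.cast_nonneg R : (0 : ℝ) ≤ R)]
  -- An approximation error with square at most `(1 - m)/2` spends half of the gap; the other half,
  -- times `N`, would have to stay bounded.
  · obtain ⟨N₀, hN₀⟩ := exists_nat_gt (((2 * R + 1) * m + (4 * R + 1) * K) / ((1 - m) / 2))
    rw [div_lt_iff₀ (by linarith)] at hN₀
    obtain ⟨N, hN, hNpos, g, hg, hlt'⟩ := hdense (Real.sqrt ((1 - m) / 2))
      (Real.sqrt_pos.2 (by linarith)) (N₀ + 2 * R)
    have h1 := h.le_sum_norm_sq_integral hNpos (by omega) hg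
    have h2 : ‖unitIndicator - g‖ ^ 2 ≤ (1 - m) / 2 := by
      rw [← Real.sq_sqrt (show 0 ≤ (1 - m) / 2 by linarith)]
      gcongr
    have h3 : (N₀ : ℝ) ≤ N := by exact_mod_cast (by omega : N₀ ≤ N)
    have h4 : (N : ℝ) * (1 - (1 - m) / 2) ≤ N * (1 - ‖unitIndicator - g‖ ^ 2) := by gcongr
    have h5 : (N₀ : ℝ) * ((1 - m) / 2) ≤ N * ((1 - m) / 2) := by
      gcongr
    change _ ≤ ((N : ℝ) + 2 * R + 1) * m + (4 * R + 1) * K at h1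
    nlinarith

end OrthonormalShifts

/-! ### Consequences of Condition E -/

section LinearAlgebra

variable {n : Type*} [Fintype n]

theorem star_smul_dotProduct_smul (c : ℂ) (v : n → ℂ) :
    dotProduct (star (c • v)) (c • v) = (‖c‖ ^ 2 : ℝ) * dotProduct (star v) v := by
  rw [star_smul, smul_dotProduct, dotProduct_smul, smul_smul, smul_eq_mul]
  congr 1
  simpa using RCLike.conj_mul c

variable [DecidableEq n] {A : Matrix n n ℂ}

theorem ConditionE.isUnit_smul_one_sub (hA : ConditionE A) {z : ℂ} (hz : 1 < ‖z‖) :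
    IsUnit (z • (1 : Matrix n n ℂ) - A) := by
  by_contra hu
  have hmem : z ∈ spectrum ℂ A := by rwa [spectrum.mem_iff, Algebra.algebraMap_eq_smul_one]
  rw [← Matrix.spectrum_toLin', ← Module.End.hasEigenvalue_iff_mem_spectrum] at hmem
  have hne : z ≠ 1 := fun h => by simp [h] at hz
  exact absurd (hA.2 z hmem hne) (not_lt.2 hz.le)

/-- Under Condition E, the fixed vectors of a matrix form a line. -/
theorem ConditionE.exists_smul_of_mulVec_eq (hA : ConditionE A) {u v : n → ℂ} (hu0 : u ≠ 0)
    (hu : A.mulVec u = u) (hv : A.mulVec v = v) : ∃ c : ℂ, v = c • u := by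
  have hmem : ∀ w : n → ℂ, A.mulVec w = w → w ∈ Module.End.eigenspace (Matrix.toLin' A) 1 :=
    fun w hw => Module.End.mem_eigenspace_iff.2 (by simpa using hw)
  -- Geometric multiplicity is at most algebraic multiplicity, which is `1`.
  have hle : Module.finrank ℂ (Module.End.eigenspace (Matrix.toLin' A) 1) ≤ 1 := by
    have := LinearMap.finrank_eigenspace_le (Matrix.toLin' A) 1
    rwa [Matrix.charpoly_toLin', hA.1] at this
  obtain ⟨w, hw⟩ := finrank_le_one_iff.1 hle
  obtain ⟨a, ha⟩ := hw ⟨u, hmem u hu⟩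
  obtain ⟨b, hb⟩ := hw ⟨v, hmem v hv⟩
  have ha' : a • (w : n → ℂ) = u := congrArg Subtype.val ha
  have hb' : b • (w : n → ℂ) = v := congrArg Subtype.val hb
  have ha0 : a ≠ 0 := fun h0 => hu0 (by rw [← ha', h0, zero_smul])
  exact ⟨b * a⁻¹, by rw [← ha', ← hb', smul_smul, mul_assoc, inv_mul_cancel₀ ha0, mul_one]⟩

end LinearAlgebra

/-! ### The doubled function and its moments -/

section Moments

variable {ι : Type*} [Fintype ι] {f : ℝ → ι → ℂ} {j : ℕ}

theorem continuousMoment_apply (hf : Integrable fun x : ℝ => (x ^ j) • f x) (a : ι) :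
    continuousMoment f j a = ∫ x : ℝ, (x : ℂ) ^ j * f x a := by
  rw [continuousMoment, eval_integral fun i => hf.eval i]
  simp

end Moments

variable {r d : ℕ} {φ f : ℝ → Fin r → ℂ} {Ap Am : ℤ → Matrix (Fin r) (Fin r) ℝ} {j : ℕ}

theorem integrable_pow_smul_doubled (hf : Integrable fun x : ℝ => (x ^ j) • f x) :
    Integrable fun x : ℝ => (x ^ j) • doubled f x := by
  refine Integrable.of_eval fun b => ?_
  rcases b with i | i
  · exact hf.eval i
  · refine ((hf.eval i).comp_neg.const_mul ((-1 : ℂ) ^ j)).congr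
      (Filter.Eventually.of_forall fun x => ?_)
    simp only [doubled, Pi.smul_apply, Sum.elim_inr, Complex.real_smul]
    push_cast
    rw [← mul_assoc, ← mul_pow]
    simp

theorem continuousMoment_eq_upperHalf (hf : Integrable fun x : ℝ => (x ^ j) • f x) :
    continuousMoment f j = upperHalf (continuousMoment (doubled f) j) := by
  funext i
  rw [upperHalf, continuousMoment_apply (integrable_pow_smul_doubled hf),
    continuousMoment_apply hf]
  rfl

theorem integrable_pow_smul (hcont : Continuous φ) (hsupp : HasCompactSupport φ) (j : ℕ) :
    Integrable fun x : ℝ => (x ^ j) • φ x :=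
  ((continuous_pow j).smul hcont).integrable_of_hasCompactSupport (hsupp.smul_left)

/-- The block matrix `[[A_k^+, A_k^-], [A_{-k}^-, A_{-k}^+]]`. -/
def blockCoeff (Ap Am : ℤ → Matrix (Fin r) (Fin r) ℝ) (k : ℤ) :
    Matrix (Fin r ⊕ Fin r) (Fin r ⊕ Fin r) ℝ :=
  Matrix.fromBlocks (Ap k) (Am k) (Am (-k)) (Ap (-k))

/-- The doubled function satisfies a one-direction series in the doubled multiscaling function. -/
theorem IsTwoDirectionSeries.isDilatedSeries (hf : IsTwoDirectionSeries d Ap Am φ f)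
    (a : Fin r ⊕ Fin r) :
    IsDilatedSeries d (fun b x => doubled φ x b) (fun k b => (blockCoeff Ap Am k a b : ℂ))
      (fun x => doubled f x a) := by
  rcases a with i | i
  · filter_upwards [hf] with x hx
    convert Pi.hasSum.1 hx i using 1
    · funext k
      simp [doubled, blockCoeff, toComplex, Matrix.mulVec, dotProduct, mul_add]
    · rfl
  -- The lower half is the relation at `-x`, valid almost everywhere since reflection preserves null
  -- sets. Reindexing by `k ↦ -k` restores the argument `d x - k` and produces the second block row.
  · have hneg : ∀ᵐ x : ℝ, HasSum (fun k : ℤ => Real.sqrt d •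
        ((toComplex (Ap k)).mulVec (φ (d * (-x) - k)) +
          (toComplex (Am k)).mulVec (φ (k - d * (-x))))) (f (-x)) :=
      (Measure.measurePreserving_neg volume).quasiMeasurePreserving.ae hf
    filter_upwards [hneg] with x hx
    convert (Equiv.neg ℤ).hasSum_iff.2 (Pi.hasSum.1 hx i) using 1
    · funext k
      have h1 : (d : ℝ) * (-x) - ((-k : ℤ) : ℝ) = -(d * x - k) := by push_cast; ring
      have h2 : ((-k : ℤ) : ℝ) - d * (-x) = d * x - k := by push_cast; ring
      simp only [Function.comp_apply, Equiv.neg_apply, h1, h2]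
      simp [doubled, blockCoeff, toComplex, Matrix.mulVec, dotProduct, mul_add, add_comm]
    · rfl

/-- The two orthogonality relations give the first block row of the Gram matrix; conjugation gives
the other off-diagonal block and the reflection `x ↦ -x` the last one. -/
theorem IsOrthogonal.exists_orthonormalShifts (horth : IsOrthogonal φ) (hcont : Continuous φ)
    (hsupp : HasCompactSupport φ) :
    ∃ R, OrthonormalShifts (fun b x => doubled φ x b) R := by
  obtain ⟨R₀, hR₀⟩ := hsupp.isCompact.isBounded.exists_norm_le
  obtain ⟨R, hR⟩ := exists_nat_ge R₀
  have hzero : ∀ y : ℝ, (R : ℝ) < |y| → φ y = 0 := fun y hy => by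
    by_contra hne
    have := hR₀ y (subset_tsupport φ hne)
    rw [Real.norm_eq_abs] at this
    linarith
  have hpp : ∀ i i' (k l : ℤ), ∫ x : ℝ, φ (x - k) i * star (φ (x - l) i') =
      (if k = l then (1 : Matrix (Fin r) (Fin r) ℂ) else 0) i i' := fun i i' k l =>
    congrFun (congrFun (horth.same k l) i) i'
  have hpm : ∀ i i' (k l : ℤ), ∫ x : ℝ, φ (x - k) i * star (φ (-(x - l)) i') = 0 :=
    fun i i' k l => by
      simp only [neg_sub]
      exact congrFun (congrFun (horth.opposite k l) i) i'
  have hmp : ∀ i i' (k l : ℤ), ∫ x : ℝ, φ (-(x - k)) i * star (φ (x - l) i') = 0 :=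
    fun i i' k l => by
      have := congrArg star (hpm i' i l k)
      rw [star_zero] at this
      rw [← this, ← starRingEnd_apply, ← integral_conj]
      simp [mul_comm]
  have hmm : ∀ i i' (k l : ℤ), ∫ x : ℝ, φ (-(x - k)) i * star (φ (-(x - l)) i') =
      (if k = l then (1 : Matrix (Fin r) (Fin r) ℂ) else 0) i i' := fun i i' k l => by
    rw [← integral_neg_eq_self]
    have := hpp i i' (-k) (-l)
    simp only [neg_inj] at this
    rw [← this]
    congr 1
    funext x
    congr 4 <;> push_cast <;> ring
  refine ⟨R, ?_, ?_, ?_, ?_⟩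
  · rintro (i | i)
    · exact (continuous_apply i).comp hcont
    · exact (continuous_apply i).comp (hcont.comp continuous_neg)
  · rintro (i | i) y hy
    · simp [doubled, hzero y hy]
    · simp [doubled, hzero (-y) (by rwa [abs_neg])]
  · have hne : ∀ (i i' : Fin r) (k l : ℤ), i ≠ i' ∨ k ≠ l →
        (if k = l then (1 : Matrix (Fin r) (Fin r) ℂ) else 0) i i' = 0 := by
      rintro i i' k l h
      split_ifs with hkl
      · exact Matrix.one_apply_ne (h.resolve_right (not_not.2 hkl))
      · rfl
    rintro (i | i) (i' | i') k l h
    · exact (hpp i i' k l).trans (hne i i' k l (h.imp_left fun h h' => h (h' ▸ rfl)))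
    · exact hpm i i' k l
    · exact hmp i i' k l
    · exact (hmm i i' k l).trans (hne i i' k l (h.imp_left fun h h' => h (h' ▸ rfl)))
  · rintro (i | i) k
    · exact (hpp i i k k).trans (by simp)
    · exact (hmm i i k k).trans (by simp)

theorem hasSum_matrix_iff {m n X : Type*} {F : X → Matrix m n ℝ} {M : Matrix m n ℝ} :
    HasSum F M ↔ ∀ a b, HasSum (fun k => F k a b) (M a b) :=
  Pi.hasSum.trans (forall_congr' fun _ => Pi.hasSum)

theorem summable_discreteMomentTerm
    (h : ∀ a b, Summable fun k : ℤ => (k : ℂ) ^ j * (blockCoeff Ap Am k a b : ℂ)) :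
    Summable (discreteMomentTerm Ap Am j) := by
  refine ⟨fun a b => ∑' k : ℤ, (k : ℝ) ^ j * blockCoeff Ap Am k a b,
    hasSum_matrix_iff.2 fun a b => Summable.hasSum ?_⟩
  have h1 := Complex.hasSum_re (h a b).hasSum
  convert h1.summable using 2 with k
  simp only [discreteMomentTerm, blockCoeff, Matrix.smul_apply, smul_eq_mul]
  norm_cast

theorem discreteMoment_apply (h : Summable (discreteMomentTerm Ap Am j)) (a b : Fin r ⊕ Fin r) :
    discreteMoment d Ap Am j a b = (Real.sqrt d : ℂ)⁻¹ *
      ∑' k : ℤ, (k : ℂ) ^ j * (blockCoeff Ap Am k a b : ℂ) := by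
  have h1 := (hasSum_matrix_iff.1 h.hasSum a b).tsum_eq
  simp only [discreteMoment, toComplex, Matrix.map_apply, Matrix.smul_apply, smul_eq_mul, ← h1,
    Complex.ofReal_mul, Complex.ofReal_tsum]
  simp [discreteMomentTerm, blockCoeff]

/-- The moments of a two-direction series. -/
theorem moments_of_isTwoDirectionSeries {R : ℕ}
    (h : OrthonormalShifts (fun b x => doubled φ x b) R) (hd : 0 < d)
    (hm : ∀ j : ℕ, Integrable fun x : ℝ => (x ^ j) • doubled φ x)
    (hf : IsTwoDirectionSeries d Ap Am φ f) (hj : Integrable fun x : ℝ => (x ^ j) • f x) :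
    (∀ i ≤ j, Summable (discreteMomentTerm Ap Am i)) ∧
    continuousMoment (doubled f) j =
      ((d : ℂ) ^ j)⁻¹ • ∑ l ∈ Finset.range (j + 1), (j.choose l : ℂ) •
        (discreteMoment d Ap Am (j - l)).mulVec (continuousMoment (doubled φ) l) := by
  have hdj := integrable_pow_smul_doubled hj
  have hα : ∀ a b, Summable fun k : ℤ =>
      (1 + |(k : ℝ)|) ^ j * ‖(blockCoeff Ap Am k a b : ℂ)‖ := fun a b =>
    h.summable_coeff hd (hf.isDilatedSeries a) (hdj.eval a) b
  have hsum : ∀ i ≤ j, Summable (discreteMomentTerm Ap Am i) := fun i hi =>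
    summable_discreteMomentTerm fun a b => summable_pow_mul_of_le hi (hα a b)
  refine ⟨hsum, funext fun a => ?_⟩
  rw [continuousMoment_apply hdj, h.integral_pow_mul_eq hd (hf.isDilatedSeries a) (hα a)]
  simp only [Pi.smul_apply, Finset.sum_apply, smul_eq_mul, Matrix.mulVec, dotProduct]
  congr 1
  refine Finset.sum_congr rfl fun l _ => ?_
  congr 1
  refine Finset.sum_congr rfl fun b _ => ?_
  rw [discreteMoment_apply (hsum _ (Nat.sub_le j l)), continuousMoment_apply (hm l)]

/-! ### Normalization from the multiresolution approximation -/

theorem scaleSpace_le_closure_span {R : ℕ} (h : OrthonormalShifts (fun b x => doubled φ x b) R)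
    {n : ℕ} (hc : (0 : ℝ) < ((d ^ n : ℕ) : ℝ)) :
    scaleSpace d φ n ≤ (Submodule.span ℂ (Set.range (h.dilateLp hc))).topologicalClosure := by
  refine Submodule.topologicalClosure_mono (Submodule.span_le.2 ?_)
  have hs : (Real.sqrt ((d ^ n : ℕ) : ℝ) : ℂ) ≠ 0 := by exact_mod_cast (Real.sqrt_pos.2 hc).ne'
  have key : ∀ (g : Lp ℂ 2 (volume : Measure ℝ)) (p : (Fin r ⊕ Fin r) × ℤ),
      (g =ᵐ[volume] fun x : ℝ => doubled φ (((d ^ n : ℕ) : ℝ) * x - p.2) p.1) →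
      g ∈ Submodule.span ℂ (Set.range (h.dilateLp hc)) := fun g p hg => by
    have : g = (Real.sqrt ((d ^ n : ℕ) : ℝ) : ℂ)⁻¹ • h.dilateLp hc p := by
      refine Lp.ext ?_
      filter_upwards [hg, h.coeFn_dilateLp hc p, Lp.coeFn_smul
        (Real.sqrt ((d ^ n : ℕ) : ℝ) : ℂ)⁻¹ (h.dilateLp hc p)] with x h1 h2 h3
      rw [h1, h3, Pi.smul_apply, h2, smul_eq_mul, inv_mul_cancel_left₀ hs]
    rw [this]
    exact Submodule.smul_mem _ _ (Submodule.subset_span ⟨p, rfl⟩)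
  rintro g ⟨i, k, hg | hg⟩
  · exact key g (Sum.inl i, k) (by simpa [doubled] using hg)
  · exact key g (Sum.inr i, k) (by simpa [doubled] using hg)

/-- Nestedness makes the union directed, so an approximant from the union lies in a single `V_n`,
and then in all later ones. -/
theorem GeneratesMRA.exists_approx (hφ : GeneratesMRA d φ) (u : Lp ℂ 2 (volume : Measure ℝ))
    {ε : ℝ} (hε : 0 < ε) : ∃ n₀ : ℕ, ∀ n : ℕ, n₀ ≤ n → ∃ g ∈ scaleSpace d φ n, ‖u - g‖ < ε := by
  have hmono : Monotone (scaleSpace d φ) := monotone_int_of_le_succ hφ.nested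
  have hu : u ∈ (⨆ n : ℤ, scaleSpace d φ n).topologicalClosure := by
    rw [hφ.dense]; exact Submodule.mem_top
  obtain ⟨g, hg, hlt⟩ := Metric.mem_closure_iff.1 hu ε hε
  obtain ⟨n, hn⟩ := (Submodule.mem_iSup_of_directed _ hmono.directed_le).1 hg
  refine ⟨n.toNat, fun m hm => ⟨g, hmono (by omega) hn, by rwa [← dist_eq_norm]⟩⟩

/-- The vector of the integrals of the doubled function is a unit vector. -/
theorem star_dotProduct_continuousMoment_zero (hd : 2 ≤ d) {R : ℕ}
    (h : OrthonormalShifts (fun b x => doubled φ x b) R) (hφ : GeneratesMRA d φ)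
    (hm : Integrable fun x : ℝ => (x ^ 0) • doubled φ x) :
    dotProduct (star (continuousMoment (doubled φ) 0)) (continuousMoment (doubled φ) 0) = 1 := by
  have hone := h.sum_norm_sq_integral_eq_one fun ε hε N₀ => by
    obtain ⟨n₀, hn₀⟩ := hφ.exists_approx unitIndicator hε
    obtain ⟨g, hg, hlt⟩ := hn₀ (max n₀ N₀) (le_max_left _ _)
    have hc : (0 : ℝ) < ((d ^ max n₀ N₀ : ℕ) : ℝ) := by
      exact_mod_cast pow_pos (by omega : 0 < d) _
    -- `d^n > n` makes the scale at least `N₀`.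
    exact ⟨d ^ max n₀ N₀, ((le_max_right n₀ N₀).trans (Nat.lt_pow_self hd).le), hc, g,
      scaleSpace_le_closure_span h hc hg, hlt⟩
  have happ : ∀ b, continuousMoment (doubled φ) 0 b = ∫ x : ℝ, doubled φ x b := fun b => by
    simpa using continuousMoment_apply hm b
  simp only [dotProduct, Pi.star_apply, happ]
  rw [← Complex.ofReal_one, ← hone, Complex.ofReal_sum]
  refine Finset.sum_congr rfl fun b _ => ?_
  simpa using RCLike.conj_mul (∫ x : ℝ, doubled φ x b)

end TwoDirection

/-! ### The theorem -/

theorem theorem3p5 (d r : ℕ) (hd : 2 ≤ d)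
    (Pp Pm : ℤ → Matrix (Fin r) (Fin r) ℝ) (φ : ℝ → Fin r → ℂ)
    (hφ : IsMultiscaling d Pp Pm φ)
    (horth : IsOrthogonal φ)
    (hsupp : HasCompactSupport φ)
    (hcont : Continuous φ)
    (hE : ConditionE (discreteMoment d Pp Pm 0)) :
    -- the discrete and continuous moments of the doubled function exist
    (∀ j : ℕ, Summable (discreteMomentTerm Pp Pm j)) ∧
    (∀ j : ℕ, Integrable (fun x : ℝ => (x ^ j) • doubled φ x)) ∧
    -- the zeroth moment is the normalized fixed vector of `M_0`, unique up to a unimodular factor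
    (discreteMoment d Pp Pm 0).mulVec (continuousMoment (doubled φ) 0)
        = continuousMoment (doubled φ) 0 ∧
    dotProduct (star (continuousMoment (doubled φ) 0)) (continuousMoment (doubled φ) 0) = 1 ∧
    (∀ v : Fin r ⊕ Fin r → ℂ,
      ((discreteMoment d Pp Pm 0).mulVec v = v ∧ dotProduct (star v) v = 1) ↔
        ∃ c : ℂ, ‖c‖ = 1 ∧ v = c • continuousMoment (doubled φ) 0) ∧
    -- the recursion for the higher moments
    (∀ j : ℕ, 1 ≤ j →
      IsUnit ((d : ℂ) ^ j • (1 : Matrix (Fin r ⊕ Fin r) (Fin r ⊕ Fin r) ℂ)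
        - discreteMoment d Pp Pm 0) ∧
      continuousMoment (doubled φ) j =
        ((d : ℂ) ^ j • (1 : Matrix (Fin r ⊕ Fin r) (Fin r ⊕ Fin r) ℂ)
          - discreteMoment d Pp Pm 0)⁻¹.mulVec
          (∑ l ∈ Finset.range j, (j.choose l : ℂ) •
            (discreteMoment d Pp Pm (j - l)).mulVec (continuousMoment (doubled φ) l))) ∧
    -- the zeroth moment and the recursion determine all moments
    (∀ a : ℕ → Fin r ⊕ Fin r → ℂ, a 0 = continuousMoment (doubled φ) 0 →
      (∀ j : ℕ, 1 ≤ j → a j =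
        ((d : ℂ) ^ j • (1 : Matrix (Fin r ⊕ Fin r) (Fin r ⊕ Fin r) ℂ)
          - discreteMoment d Pp Pm 0)⁻¹.mulVec
          (∑ l ∈ Finset.range j, (j.choose l : ℂ) •
            (discreteMoment d Pp Pm (j - l)).mulVec (a l))) →
      ∀ j : ℕ, a j = continuousMoment (doubled φ) j) ∧
    -- the moments of `φ`
    (∀ j : ℕ, continuousMoment φ j = upperHalf (continuousMoment (doubled φ) j)) ∧
    -- the moments of the multiwavelets, as far as they exist
    (∀ (Qp Qm : Fin (d - 1) → ℤ → Matrix (Fin r) (Fin r) ℝ)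
      (ψ : Fin (d - 1) → ℝ → Fin r → ℂ),
      (∀ s, IsTwoDirectionSeries d (Qp s) (Qm s) φ (ψ s)) →
      ∀ (s : Fin (d - 1)) (j : ℕ), Integrable (fun x : ℝ => (x ^ j) • ψ s x) →
        (∀ i ≤ j, Summable (discreteMomentTerm (Qp s) (Qm s) i)) ∧
        Integrable (fun x : ℝ => (x ^ j) • doubled (ψ s) x) ∧
        continuousMoment (doubled (ψ s)) j =
          ((d : ℂ) ^ j)⁻¹ • ∑ l ∈ Finset.range (j + 1), (j.choose l : ℂ) •
            (discreteMoment d (Qp s) (Qm s) (j - l)).mulVec (continuousMoment (doubled φ) l) ∧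
        continuousMoment (ψ s) j = upperHalf (continuousMoment (doubled (ψ s)) j)) := by
  have hd0 : 0 < d := by omega
  have hdc : (d : ℂ) ≠ 0 := by exact_mod_cast hd0.ne'
  obtain ⟨R, hR⟩ := horth.exists_orthonormalShifts hcont hsupp
  have hint := integrable_pow_smul hcont hsupp
  have hm : ∀ j : ℕ, Integrable fun x : ℝ => (x ^ j) • doubled φ x := fun j =>
    integrable_pow_smul_doubled (hint j)
  have hmom := fun j => moments_of_isTwoDirectionSeries hR hd0 hm hφ.refinement (hint j)
  have hfix : (discreteMoment d Pp Pm 0).mulVec (continuousMoment (doubled φ) 0)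
      = continuousMoment (doubled φ) 0 := by
    simpa using (hmom 0).2.symm
  have hone := star_dotProduct_continuousMoment_zero hd hR hφ.generates (hm 0)
  have hne : continuousMoment (doubled φ) 0 ≠ 0 := fun h0 => by simp [h0] at hone
  have hunit : ∀ j : ℕ, 1 ≤ j →
      IsUnit ((d : ℂ) ^ j • (1 : Matrix (Fin r ⊕ Fin r) (Fin r ⊕ Fin r) ℂ)
        - discreteMoment d Pp Pm 0) := fun j hj => hE.isUnit_smul_one_sub <| by
    rw [norm_pow, Complex.norm_natCast]
    exact one_lt_pow₀ (by exact_mod_cast hd) (by omega)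
  have hrec : ∀ j : ℕ, 1 ≤ j → continuousMoment (doubled φ) j =
      ((d : ℂ) ^ j • (1 : Matrix (Fin r ⊕ Fin r) (Fin r ⊕ Fin r) ℂ)
        - discreteMoment d Pp Pm 0)⁻¹.mulVec
        (∑ l ∈ Finset.range j, (j.choose l : ℂ) •
          (discreteMoment d Pp Pm (j - l)).mulVec (continuousMoment (doubled φ) l)) := by
    intro j hj
    -- Multiply the moment formula by `d^j` and move its `l = j` term, `M_0 m_j`, to the left.
    have h1 := congrArg (fun v => (d : ℂ) ^ j • v) (hmom j).2
    simp only [smul_smul, mul_inv_cancel₀ (pow_ne_zero j hdc), one_smul] at h1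
    rw [Finset.sum_range_succ, Nat.choose_self, Nat.sub_self, Nat.cast_one, one_smul] at h1
    rw [← sub_eq_of_eq_add h1]
    have h2 : (d : ℂ) ^ j • continuousMoment (doubled φ) j -
        (discreteMoment d Pp Pm 0).mulVec (continuousMoment (doubled φ) j) =
        ((d : ℂ) ^ j • (1 : Matrix (Fin r ⊕ Fin r) (Fin r ⊕ Fin r) ℂ)
          - discreteMoment d Pp Pm 0).mulVec (continuousMoment (doubled φ) j) := by
      rw [Matrix.sub_mulVec, Matrix.smul_mulVec, Matrix.one_mulVec]
    rw [h2, Matrix.mulVec_mulVec,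
      Matrix.nonsing_inv_mul _ ((Matrix.isUnit_iff_isUnit_det _).1 (hunit j hj)),
      Matrix.one_mulVec]
  refine ⟨fun j => (hmom j).1 j le_rfl, hm, hfix, hone, fun v => ⟨?_, ?_⟩,
    fun j hj => ⟨hunit j hj, hrec j hj⟩, ?_, fun j => continuousMoment_eq_upperHalf (hint j), ?_⟩
  · rintro ⟨hv, hv1⟩
    obtain ⟨c, rfl⟩ := hE.exists_smul_of_mulVec_eq hne hfix hv
    refine ⟨c, ?_, rfl⟩
    rw [star_smul_dotProduct_smul, hone, mul_one] at hv1
    exact (pow_eq_one_iff_of_nonneg (norm_nonneg _) two_ne_zero).1 (by exact_mod_cast hv1)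
  · rintro ⟨c, hc, rfl⟩
    refine ⟨by rw [Matrix.mulVec_smul, hfix], ?_⟩
    rw [star_smul_dotProduct_smul, hone, hc]
    simp
  · intro a ha0 ha j
    induction j using Nat.strong_induction_on with
    | _ j ih =>
      rcases Nat.eq_zero_or_pos j with rfl | hj
      · exact ha0
      · rw [ha j hj, hrec j hj]
        congr 1
        exact Finset.sum_congr rfl fun l hl => by rw [ih l (Finset.mem_range.1 hl)]
  · intro Qp Qm ψ hψ s j hj
    obtain ⟨h1, h2⟩ := moments_of_isTwoDirectionSeries hR hd0 hm (hψ s) hj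
    exact ⟨h1, integrable_pow_smul_doubled hj, h2, continuousMoment_eq_upperHalf hj⟩
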